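/- A tree is a strictly partially ordered set $(T,<_T)$ in which the predecessors of every element are well ordered by $<_T$. A branch is a maximal chain, its length is its order type, and an $\alpha$-branch is a branch of length $\alpha$. A $(\lambda,\kappa)$-tree is a tree in which every branch has length less than $\kappa$ and every element has fewer than $\lambda$ immediate successors. A $\kappa$-representation of a tree is a tree $T$ whose domain is the ordinal $\kappa$ and for which $x<_T y$ implies $x<y$; for $\alpha<\kappa$, $T\cap\alpha$ denotes the subtree of $T$ with domain $\alpha$. The tree $T$ is weakly semi-proper if there is a (nonempty) forcing notion $P$ that adds a $\kappa$-branch to $T$ (every condition forces that $T$ has a $\kappa$-branch), preserves stationary subsets of $\kappa$, and adds no sets of cardinality less than $\kappa$ (in the generic extension, every set of cardinality less than $\kappa$ consisting of elements of the ground model belongs to the ground model). **Lemma.** Let $\kappa$ be a regular uncountable cardinal, let $T$ be a $\kappa$-representation of a $(\kappa^+,\kappa)$-tree, and let $$S=\{\alpha<\kappa : T\cap\alpha \text{ has no } \alpha\text{-branch}\}.$$ 1. If $S$ is stationary in $\kappa$, then $T$ is not weakly semi-proper. 2. For every forcing notion $P$ and every $p\in P$: if $p$ forces that $T$ has a $\kappa$-branch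 and that $\kappa$ is a regular cardinal, then $p$ forces that there is a club $C\subseteq\kappa$ with $C\cap\check S=\emptyset$. (Here $S$ is computed in the ground model.) -/

import Mathlib

universe u

open Cardinal

/-! ### Trees and branches in the ground model

A tree is given by its strict order `r` on a type `X`. -/

/-- `r` is the strict order of a tree: a strict partial order in which the predecessors of every
element are well ordered. -/
structure IsTreeOrder {X : Type u} (r : X → X → Prop) : Prop where
  irrefl : ∀ x, ¬ r x x
  trans : ∀ x y z, r x y → r y z → r x z
  wellOrdered : ∀ x, IsWellOrder {y : X // r y x} (fun y z => r y.1 z.1)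

/-- `b` is a branch of the subtree with domain `D`: a maximal chain contained in `D`. -/
structure IsBranchIn {X : Type u} (r : X → X → Prop) (D b : Set X) : Prop where
  subset : b ⊆ D
  chain : ∀ x ∈ b, ∀ y ∈ b, x = y ∨ r x y ∨ r y x
  maximal : ∀ x ∈ D, (∀ y ∈ b, x = y ∨ r x y ∨ r y x) → x ∈ b

/-- The order type of `b` under `r` is the order type of the (well-ordered) type `Y`. -/
def HasLength {X Y : Type u} [LT Y] (r : X → X → Prop) (b : Set X) : Prop :=
  Nonempty ((fun x y : b => r x.1 y.1) ≃r (fun i j : Y => i < j))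

/-- `y` is an immediate successor of `x`. -/
def IsImmediateSucc {X : Type u} (r : X → X → Prop) (x y : X) : Prop :=
  r x y ∧ ¬ ∃ z, r x z ∧ r z y

/-- `(μ, κ)`-trees: every branch has length less than `κ` and every element has fewer than `μ`
immediate successors. -/
structure IsCardTree {X : Type u} (μ κ : Cardinal.{u}) (r : X → X → Prop) : Prop where
  isTree : IsTreeOrder r
  branch_length : ∀ b : Set X, IsBranchIn r Set.univ b →
    ∃ o : Ordinal.{u}, o < κ.ord ∧ HasLength (Y := o.ToType) r b
  succ_lt : ∀ x : X, #{y : X // IsImmediateSucc r x y} < μ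

/-- A `κ`-representation of a tree: a tree order on the ordinal `κ` (the canonical well-ordered type
`κ.ord.ToType`) such that `x <_T y` implies `x < y`. -/
structure IsRepresentation (κ : Cardinal.{u}) (r : κ.ord.ToType → κ.ord.ToType → Prop) :
    Prop where
  isTree : IsTreeOrder r
  lt_of_rel : ∀ x y, r x y → x < y

/-- The set of `α < κ` such that `T ∩ α` has no `α`-branch, i.e. no branch of length `α`. -/
def noBranchSet (κ : Cardinal.{u}) (r : κ.ord.ToType → κ.ord.ToType → Prop) :
    Set κ.ord.ToType :=
  {a | ¬ ∃ b : Set κ.ord.ToType, IsBranchIn r (Set.Iio a) b ∧ HasLength (Y := Set.Iio a) r b}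

/-! ### Names and the forcing relation

A forcing notion is a nonempty preorder `P`; `p ≤ q` means that `p` is stronger than `q`. -/

namespace Forcing

/-- `P`-names: a name is a (small) family of pairs (name, condition). -/
inductive PName (P : Type u) : Type (u + 1)
  | mk (ι : Type u) (elt : ι → PName P) (cond : ι → P) : PName P

/-- A sentence of the forcing language, represented by the set of conditions that force it:
`φ p` is read "`p` forces `φ`". -/
abbrev Sentence (P : Type u) : Type u := P → Prop

section
variable {P : Type u} [Preorder P]

/-- `p` forces that two names are equal. -/
def feq : PName P → PName P → Sentence P
  | .mk ι x c, .mk ι' y d => fun p =>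
      (∀ i : ι, ∀ q, q ≤ p → q ≤ c i → ∃ r, r ≤ q ∧ ∃ j : ι', r ≤ d j ∧ feq (x i) (y j) r) ∧
      (∀ j : ι', ∀ q, q ≤ p → q ≤ d j → ∃ r, r ≤ q ∧ ∃ i : ι, r ≤ c i ∧ feq (x i) (y j) r)

/-- `p` forces that one name is an element of another. -/
def fmem (x : PName P) : PName P → Sentence P
  | .mk ι y d => fun p => ∀ q, q ≤ p → ∃ r, r ≤ q ∧ ∃ i : ι, r ≤ d i ∧ feq x (y i) r

/-- Conjunction. -/
def fand (φ ψ : Sentence P) : Sentence P := fun p => φ p ∧ ψ p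

/-- Disjunction. -/
def for' (φ ψ : Sentence P) : Sentence P := fun p => ∀ q, q ≤ p → ∃ r, r ≤ q ∧ (φ r ∨ ψ r)

/-- Implication. -/
def fimp (φ ψ : Sentence P) : Sentence P := fun p => ∀ q, q ≤ p → φ q → ψ q

/-- Negation. -/
def fnot (φ : Sentence P) : Sentence P := fun p => ∀ q, q ≤ p → ¬ φ q

/-- Universal quantification. -/
def fall {I : Type*} (φ : I → Sentence P) : Sentence P := fun p => ∀ x, φ x p

/-- Existential quantification. -/
def fex {I : Type*} (φ : I → Sentence P) : Sentence P :=
  fun p => ∀ q, q ≤ p → ∃ r, r ≤ q ∧ ∃ x, φ x r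

infix:70 " ≐ᶠ " => feq
infix:70 " ∈ᶠ " => fmem
infixr:60 " ∧ᶠ " => fand
infixr:55 " ∨ᶠ " => for'
infixr:50 " →ᶠ " => fimp

/-- `∀ x ∈ A, φ x`. -/
def fball (A : PName P) (φ : PName P → Sentence P) : Sentence P :=
  fall fun x => x ∈ᶠ A →ᶠ φ x

/-- `∃ x ∈ A, φ x`. -/
def fbex (A : PName P) (φ : PName P → Sentence P) : Sentence P :=
  fex fun x => x ∈ᶠ A ∧ᶠ φ x

/-! #### Canonical names -/

/-- The name of the unordered pair `{x, y}`. -/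
def pairName (x y : PName P) : PName P :=
  .mk (ULift.{u} Bool × P) (fun i => cond i.1.down x y) (fun i => i.2)

/-- The name of the ordered pair `(x, y) = {{x}, {x, y}}`. -/
def opName (x y : PName P) : PName P := pairName (pairName x x) (pairName x y)

/-- The canonical (check) name of a set of the ground model. -/
def check (P : Type u) : PSet.{u} → PName P
  | .mk ι A => .mk (ι × P) (fun i => check P (A i.1)) (fun i => i.2)

/-- The von Neumann ordinal of the elements below `a` in a well-ordered type. -/
noncomputable def vonNeumann {X : Type u} [LinearOrder X] [WellFoundedLT X] (a : X) : PSet.{u} :=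
  .mk {b : X // b < a} (fun b => vonNeumann b.1)
termination_by wellFounded_lt.wrap a
decreasing_by exact b.2

/-- The canonical name of an element `a` of a well-ordered type, seen as an ordinal. -/
noncomputable def ordName (P : Type u) {X : Type u} [LinearOrder X] [WellFoundedLT X] (a : X) :
    PName P :=
  check P (vonNeumann a)

/-- The canonical name of a set of ordinals; the whole ordinal is `setName P Set.univ`. -/
noncomputable def setName (P : Type u) {X : Type u} [LinearOrder X] [WellFoundedLT X]
    (A : Set X) : PName P :=
  check P (.mk A fun a => vonNeumann a.1)

/-- The canonical name of a binary relation, as a set of ordered pairs. -/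
noncomputable def relName (P : Type u) {X : Type u} [LinearOrder X] [WellFoundedLT X]
    (r : X → X → Prop) : PName P :=
  .mk ({ab : X × X // r ab.1 ab.2} × P)
    (fun i => opName (ordName P i.1.1.1) (ordName P i.1.1.2)) (fun i => i.2)

/-! #### Set theory in the forcing language -/

/-- `x ⊆ y`. -/
def fsubset (x y : PName P) : Sentence P := fball x fun z => z ∈ᶠ y

/-- `f` is a function from `A` to `B`. -/
def ffun (f A B : PName P) : Sentence P :=
  (fball f fun z => fbex A fun x => fbex B fun y => z ≐ᶠ opName x y) ∧ᶠ
  (fball A fun x => fbex B fun y =>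
    opName x y ∈ᶠ f ∧ᶠ fall fun y' => opName x y' ∈ᶠ f →ᶠ y' ≐ᶠ y)

/-- `f` is a function from `A` onto `B`. -/
def fsurj (f A B : PName P) : Sentence P :=
  ffun f A B ∧ᶠ fball B fun y => fbex A fun x => opName x y ∈ᶠ f

/-- `f` is an isomorphism from `(A, ∈)` onto `(B, R)`. -/
def fiso (f A B R : PName P) : Sentence P :=
  fsurj f A B ∧ᶠ
  fball A fun x => fball A fun x' => fall fun y => fall fun y' =>
    opName x y ∈ᶠ f →ᶠ opName x' y' ∈ᶠ f →ᶠ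
      (y ≐ᶠ y' →ᶠ x ≐ᶠ x') ∧ᶠ (x ∈ᶠ x' →ᶠ opName y y' ∈ᶠ R) ∧ᶠ (opName y y' ∈ᶠ R →ᶠ x ∈ᶠ x')

/-- `x` and `y` are equal or related by `R` in one of the two directions. -/
def fcomparable (R x y : PName P) : Sentence P :=
  x ≐ᶠ y ∨ᶠ opName x y ∈ᶠ R ∨ᶠ opName y x ∈ᶠ R

/-- `B` is a branch, i.e. a maximal chain, of the tree with domain `D` and strict order `R`. -/
def fbranch (B D R : PName P) : Sentence P :=
  fsubset B D ∧ᶠ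
  (fball B fun x => fball B fun y => fcomparable R x y) ∧ᶠ
  (fball D fun x => (fball B fun y => fcomparable R x y) →ᶠ x ∈ᶠ B)

/-- `B` is a branch of length `k` of the tree with domain `D` and strict order `R`. -/
def fbranchOfLength (k B D R : PName P) : Sentence P :=
  fbranch B D R ∧ᶠ fex fun f => fiso f k B R

/-- The ordinal `k` is a regular cardinal: it is a nonzero limit ordinal, and every function from
a smaller ordinal to `k` is bounded. -/
def fregular (k : PName P) : Sentence P :=
  (fex fun x => x ∈ᶠ k) ∧ᶠ
  (fball k fun x => fbex k fun y => x ∈ᶠ y) ∧ᶠ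
  (fball k fun l => fall fun f => ffun f l k →ᶠ
    fbex k fun b => fball l fun x => fall fun y => opName x y ∈ᶠ f →ᶠ y ∈ᶠ b)

/-- `C` is a closed unbounded subset of the ordinal `k`. -/
def fclub (C k : PName P) : Sentence P :=
  fsubset C k ∧ᶠ
  (fball k fun x => fbex C fun y => x ∈ᶠ y) ∧ᶠ
  (fball k fun d => (fex fun x => x ∈ᶠ d) →ᶠ
    (fball d fun x => fbex d fun y => y ∈ᶠ C ∧ᶠ x ∈ᶠ y) →ᶠ d ∈ᶠ C)

/-- `A` is a stationary subset of the ordinal `k`: it meets every club. -/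
def fstationary (A k : PName P) : Sentence P :=
  fall fun C => fclub C k →ᶠ fex fun x => x ∈ᶠ C ∧ᶠ x ∈ᶠ A

/-- `A` and `B` are disjoint. -/
def fdisjoint (A B : PName P) : Sentence P :=
  fnot (fex fun x => x ∈ᶠ A ∧ᶠ x ∈ᶠ B)

/-- `x` has cardinality less than `k`: some ordinal below `k` is mapped onto `x`. -/
def fcardLT (x k : PName P) : Sentence P :=
  fbex k fun l => fex fun f => fsurj f l x

/-- `x` belongs to the ground model. -/
def fground (x : PName P) : Sentence P :=
  fex fun y : PSet.{u} => x ≐ᶠ check P y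

end

/-! #### Forcing with `P`, the cardinal `κ` and a tree on `κ` -/

section
variable (P : Type u) [Preorder P] (κ : Cardinal.{u})

/-- The canonical name of the ordinal `κ`. -/
noncomputable def cardName : PName P :=
  setName P (Set.univ : Set κ.ord.ToType)

/-- "The tree `(κ, r)` has a `κ`-branch." -/
noncomputable def fhasBranch (r : κ.ord.ToType → κ.ord.ToType → Prop) : Sentence P :=
  fex fun B => fbranchOfLength (cardName P κ) B (cardName P κ) (relName P r)

/-- Stationary subsets of `κ` remain stationary in the generic extensions by `P`. -/
def PreservesStationary : Prop :=
  ∀ A : Set κ.ord.ToType, IsStationary A → ∀ p : P, fstationary (setName P A) (cardName P κ) p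

/-- `P` adds no sets of cardinality less than `κ`: in the generic extensions by `P`, every set of
cardinality less than `κ` whose elements are in the ground model is itself in the ground model. -/
def AddsNoSmallSets : Prop :=
  ∀ (x : PName P) (p : P),
    ((fball x fun z => fground z) ∧ᶠ fcardLT x (cardName P κ) →ᶠ fground x) p

end

/-- The tree `(κ, r)` is weakly semi-proper: some forcing notion adds a `κ`-branch to it, preserves
stationary subsets of `κ` and adds no sets of cardinality less than `κ`. -/
def WeaklySemiProper (κ : Cardinal.{u}) (r : κ.ord.ToType → κ.ord.ToType → Prop) : Prop :=
  ∃ (P : Type u) (_ : Preorder P), Nonempty P ∧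
    (∀ p : P, fhasBranch P κ r p) ∧ PreservesStationary P κ ∧ AddsNoSmallSets P κ

end Forcing

/-! Let `f` be a name for the isomorphism from `κ` onto a `κ`-branch. The ordinals `a` with `f i <
a` for all `i < a` form a club, because `κ` is regular and uncountable in the extension
(`fclub_closurePoints`). For such an `a` with value `v = f a`, the `T`-predecessors of `v` are
exactly the values `f i` with `i < a`. They all lie below `a` and form a branch of `T ∩ a` of length
`a` (`isBranchIn_predecessors`, `hasLength_predecessors`). This set is defined from `v` and the tree
alone, so it belongs to the ground model and `a ∉ S`. Hence the club of closure points misses `S`.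

The first claim reduces to the second. A forcing that adds no small sets keeps `κ` regular, since a
function from a smaller ordinal to `κ` is a small set of ground model pairs (`fregular_of_fground`).
The resulting club disjoint from `S` contradicts the preservation of the stationarity of `S`.

Most of the argument treats `f` as a relation `F i x` between ground model ordinals with values in
the forcing language, and returns to names only to apply regularity or to exhibit the club. -/

namespace Forcing

/-! ### Forced equality and membership -/

section
variable {P : Type u} [Preorder P] {p q : P} {x y z x' y' : PName P}

theorem feq_mono (h : feq x y p) (hq : q ≤ p) : feq x y q := by
  cases x; cases y
  rw [feq] at h ⊢
  exact ⟨fun i s hs => h.1 i s (hs.trans hq), fun j s hs => h.2 j s (hs.trans hq)⟩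

/-- Both clauses of `feq` only ask for witnesses below each extension, so density passes through
without induction. -/
theorem feq_of_dense (h : ∀ q ≤ p, ∃ r ≤ q, feq x y r) : feq x y p := by
  cases x; cases y
  rw [feq]
  refine ⟨fun i q hq hi => ?_, fun j q hq hj => ?_⟩
  · obtain ⟨r, hr, h⟩ := h q hq
    rw [feq] at h
    obtain ⟨s, hs, h⟩ := h.1 i r le_rfl (hr.trans hi)
    exact ⟨s, hs.trans hr, h⟩
  · obtain ⟨r, hr, h⟩ := h q hq
    rw [feq] at h
    obtain ⟨s, hs, h⟩ := h.2 j r le_rfl (hr.trans hj)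
    exact ⟨s, hs.trans hr, h⟩

theorem feq_refl (x : PName P) (p : P) : feq x x p := by
  induction x generalizing p with
  | mk ι x c ih =>
    rw [feq]
    exact ⟨fun i q _ hi => ⟨q, le_rfl, i, hi, ih i q⟩, fun i q _ hi => ⟨q, le_rfl, i, hi, ih i q⟩⟩

theorem feq_symm (h : feq x y p) : feq y x p := by
  induction x generalizing y p with
  | mk ι x c ih =>
    cases y
    rw [feq] at h ⊢
    refine ⟨fun j q hq hj => ?_, fun i q hq hi => ?_⟩
    · obtain ⟨r, hr, i, hi, h⟩ := h.2 j q hq hj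
      exact ⟨r, hr, i, hi, ih i h⟩
    · obtain ⟨r, hr, j, hj, h⟩ := h.1 i q hq hi
      exact ⟨r, hr, j, hj, ih i h⟩

theorem feq_trans (h₁ : feq x y p) (h₂ : feq y z p) : feq x z p := by
  induction x generalizing y z p with
  | mk ι x c ih =>
    cases y; cases z
    rw [feq] at h₁ h₂ ⊢
    refine ⟨fun i q hq hi => ?_, fun k q hq hk => ?_⟩
    · obtain ⟨r, hr, j, hj, e₁⟩ := h₁.1 i q hq hi
      obtain ⟨s, hs, k, hk, e₂⟩ := h₂.1 j r (hr.trans hq) hj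
      exact ⟨s, hs.trans hr, k, hk, ih i (feq_mono e₁ hs) e₂⟩
    · obtain ⟨r, hr, j, hj, e₂⟩ := h₂.2 k q hq hk
      obtain ⟨s, hs, i, hi, e₁⟩ := h₁.2 j r (hr.trans hq) hj
      exact ⟨s, hs.trans hr, i, hi, ih i e₁ (feq_mono e₂ hs)⟩

theorem fmem_mono (h : fmem x y p) (hq : q ≤ p) : fmem x y q := by
  cases y
  rw [fmem] at h ⊢
  exact fun s hs => h s (hs.trans hq)

theorem fmem_of_dense (h : ∀ q ≤ p, ∃ r ≤ q, fmem x y r) : fmem x y p := by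
  cases y
  rw [fmem]
  intro q hq
  obtain ⟨r, hr, h⟩ := h q hq
  rw [fmem] at h
  obtain ⟨s, hs, h⟩ := h r le_rfl
  exact ⟨s, hs.trans hr, h⟩

theorem fmem_congr_left (e : feq x x' p) (h : fmem x y p) : fmem x' y p := by
  cases y
  rw [fmem] at h ⊢
  intro q hq
  obtain ⟨r, hr, i, hi, h⟩ := h q hq
  exact ⟨r, hr, i, hi, feq_trans (feq_symm (feq_mono e (hr.trans hq))) h⟩

theorem fmem_congr_right (e : feq y y' p) (h : fmem x y p) : fmem x y' p := by
  cases y; cases y'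
  rw [fmem] at h ⊢
  rw [feq] at e
  intro q hq
  obtain ⟨r, hr, i, hi, h⟩ := h q hq
  obtain ⟨s, hs, j, hj, e⟩ := e.1 i r (hr.trans hq) hi
  exact ⟨s, hs.trans hr, j, hj, feq_trans (feq_mono h hs) e⟩

/-- The name of the set of all `e i` such that `φ i` holds. -/
def comprehension {ι : Type u} (e : ι → PName P) (φ : ι → Sentence P) : PName P :=
  .mk {i : ι × P // φ i.1 i.2} (fun i => e i.1.1) (fun i => i.1.2)

theorem exists_of_fmem_comprehension {ι : Type u} {e : ι → PName P} {φ : ι → Sentence P}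
    (hφ : ∀ i p q, q ≤ p → φ i p → φ i q) (h : fmem x (comprehension e φ) p) (hq : q ≤ p) :
    ∃ r ≤ q, ∃ i, φ i r ∧ feq x (e i) r := by
  rw [comprehension, fmem] at h
  obtain ⟨r, hr, ⟨⟨i, s⟩, hi⟩, hs, h⟩ := h q hq
  exact ⟨r, hr, i, hφ i s r hs hi, h⟩

theorem fmem_comprehension {ι : Type u} {e : ι → PName P} {φ : ι → Sentence P} {i : ι}
    (hi : φ i p) (h : feq x (e i) p) : fmem x (comprehension e φ) p := by
  rw [comprehension, fmem]
  exact fun q hq => ⟨q, le_rfl, ⟨(i, p), hi⟩, hq, feq_mono h hq⟩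

/-! #### Ordered pairs -/

theorem exists_of_fmem_pairName (h : fmem z (pairName x y) p) (hq : q ≤ p) :
    ∃ r ≤ q, feq z x r ∨ feq z y r := by
  rw [pairName, fmem] at h
  obtain ⟨r, hr, ⟨⟨b⟩, s⟩, hs, h⟩ := h q hq
  cases b
  · exact ⟨r, hr, Or.inr h⟩
  · exact ⟨r, hr, Or.inl h⟩

theorem fmem_pairName_left (h : feq z x p) : fmem z (pairName x y) p := by
  rw [pairName, fmem]
  exact fun q hq => ⟨q, le_rfl, (⟨true⟩, q), le_rfl, feq_mono h hq⟩

theorem fmem_pairName_right (h : feq z y p) : fmem z (pairName x y) p := by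
  rw [pairName, fmem]
  exact fun q hq => ⟨q, le_rfl, (⟨false⟩, q), le_rfl, feq_mono h hq⟩

theorem pairName_congr (hx : feq x x' p) (hy : feq y y' p) :
    feq (pairName x y) (pairName x' y') p := by
  rw [pairName, pairName, feq]
  refine ⟨?_, ?_⟩ <;> rintro ⟨⟨b⟩, s⟩ q hq hs <;>
    refine ⟨q, le_rfl, (⟨b⟩, q), le_rfl, ?_⟩ <;> cases b
  exacts [feq_mono hy hq, feq_mono hx hq, feq_mono hy hq, feq_mono hx hq]

theorem opName_congr (hx : feq x x' p) (hy : feq y y' p) :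
    feq (opName x y) (opName x' y') p :=
  pairName_congr (pairName_congr hx hx) (pairName_congr hx hy)

theorem feq_of_singleton_feq_pairName (h : feq (pairName x x) (pairName x' y') p) :
    feq x x' p ∧ feq x y' p := by
  constructor <;> refine feq_of_dense fun q hq => ?_
  · obtain ⟨r, hr, e | e⟩ := exists_of_fmem_pairName
      (fmem_congr_right (feq_symm h) (fmem_pairName_left (feq_refl x' p))) hq <;>
    exact ⟨r, hr, feq_symm e⟩
  · obtain ⟨r, hr, e | e⟩ := exists_of_fmem_pairName
      (fmem_congr_right (feq_symm h) (fmem_pairName_right (feq_refl y' p))) hq <;>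
    exact ⟨r, hr, feq_symm e⟩

/-- In the only crossed case `y' = x` and `y = x'`, and then all four names coincide. -/
theorem feq_right_of_pairName_feq (hx : feq x x' p) (h : feq (pairName x y) (pairName x' y') p) :
    feq y y' p := by
  refine feq_of_dense fun q hq => ?_
  obtain ⟨r, hr, e | e⟩ := exists_of_fmem_pairName
      (fmem_congr_right (feq_symm h) (fmem_pairName_right (feq_refl y' p))) hq
  · obtain ⟨s, hs, e' | e'⟩ := exists_of_fmem_pairName
      (fmem_congr_right h (fmem_pairName_right (feq_refl y p))) (hr.trans hq)
    · exact ⟨s, hs.trans hr, feq_trans e' (feq_trans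
        (feq_symm (feq_mono hx (hs.trans (hr.trans hq)))) (feq_symm (feq_mono e hs)))⟩
    · exact ⟨s, hs.trans hr, e'⟩
  · exact ⟨r, hr, feq_symm e⟩

theorem feq_left_of_opName_feq (h : feq (opName x y) (opName x' y') p) : feq x x' p := by
  refine feq_of_dense fun q hq => ?_
  obtain ⟨r, hr, e | e⟩ := exists_of_fmem_pairName
    (fmem_congr_right h (fmem_pairName_left (feq_refl (pairName x x) p))) hq <;>
  exact ⟨r, hr, (feq_of_singleton_feq_pairName e).1⟩

theorem feq_right_of_opName_feq (h : feq (opName x y) (opName x' y') p) : feq y y' p := by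
  have hx := feq_left_of_opName_feq h
  refine feq_of_dense fun q hq => ?_
  obtain ⟨r, hr, e | e⟩ := exists_of_fmem_pairName
    (fmem_congr_right h (fmem_pairName_right (feq_refl (pairName x y) p))) hq
  -- Degenerate case `{x, y} = {x'}`, so `y = x'`; the position of `{x', y'}` in the first pair
  -- settles `y'`.
  · obtain ⟨s, hs, e' | e'⟩ := exists_of_fmem_pairName
      (fmem_congr_right (feq_symm h) (fmem_pairName_right (feq_refl (pairName x' y') p)))
      (hr.trans hq)
    · refine ⟨s, hs.trans hr, feq_trans
        (feq_symm (feq_of_singleton_feq_pairName (feq_symm (feq_mono e hs))).2)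
        (feq_trans (feq_symm (feq_mono hx (hs.trans (hr.trans hq)))) ?_)⟩
      exact (feq_of_singleton_feq_pairName (feq_symm e')).2
    · exact ⟨s, hs.trans hr, feq_right_of_pairName_feq
        (feq_mono hx (hs.trans (hr.trans hq))) (feq_symm e')⟩
  · exact ⟨r, hr, feq_right_of_pairName_feq (feq_mono hx (hr.trans hq)) e⟩

/-! #### Names of ground model sets -/

theorem exists_of_fmem_check {ι : Type u} {A : ι → PSet.{u}}
    (h : fmem x (check P (.mk ι A)) p) (hq : q ≤ p) :
    ∃ r ≤ q, ∃ i, feq x (check P (A i)) r := by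
  rw [check, fmem] at h
  obtain ⟨r, hr, ⟨i, s⟩, _, h⟩ := h q hq
  exact ⟨r, hr, i, h⟩

theorem fmem_check {ι : Type u} {A : ι → PSet.{u}} {i : ι} (h : feq x (check P (A i)) p) :
    fmem x (check P (.mk ι A)) p := by
  rw [check, fmem]
  exact fun q hq => ⟨q, le_rfl, (i, q), le_rfl, feq_mono h hq⟩

/-- Equality of ground model sets does not depend on the condition. -/
theorem feq_check_of_feq_check {A B : PSet.{u}} (h : feq (check P A) (check P B) p) (q : P) :
    feq (check P A) (check P B) q := by
  induction A generalizing B p q with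
  | mk ι A ih =>
    obtain ⟨ι', B⟩ := B
    rw [check, check, feq] at h ⊢
    refine ⟨?_, ?_⟩
    · rintro ⟨i, -⟩ s - -
      obtain ⟨r, -, j, -, h⟩ := h.1 (i, p) p le_rfl le_rfl
      exact ⟨s, le_rfl, (j.1, s), le_rfl, ih i h s⟩
    · rintro ⟨j, -⟩ s - -
      obtain ⟨r, -, i, -, h⟩ := h.2 (j, p) p le_rfl le_rfl
      exact ⟨s, le_rfl, (i.1, s), le_rfl, ih i.1 h s⟩

/-- The unordered pair of two ground model sets. -/
def groundPair (A B : PSet.{u}) : PSet.{u} :=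
  .mk (ULift.{u} Bool) fun i => cond i.down A B

omit [Preorder P] in
theorem check_groundPair (A B : PSet.{u}) :
    check P (groundPair A B) = pairName (check P A) (check P B) := by
  rw [groundPair, check, pairName]
  congr 1
  funext ⟨⟨b⟩, s⟩
  cases b <;> rfl

/-- The ordered pair of two ground model sets. -/
def groundOp (A B : PSet.{u}) : PSet.{u} :=
  groundPair (groundPair A A) (groundPair A B)

omit [Preorder P] in
theorem check_groundOp (A B : PSet.{u}) :
    check P (groundOp A B) = opName (check P A) (check P B) := by
  simp only [groundOp, check_groundPair, opName]

section
variable {X : Type u} [LinearOrder X] [WellFoundedLT X] {a b c d : X} {A : Set X}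

theorem exists_of_fmem_ordName (h : fmem x (ordName P a) p) (hq : q ≤ p) :
    ∃ r ≤ q, ∃ b < a, feq x (ordName P b) r := by
  rw [ordName, vonNeumann] at h
  obtain ⟨r, hr, i, h⟩ := exists_of_fmem_check h hq
  exact ⟨r, hr, i.1, i.2, h⟩

theorem fmem_ordName (h : feq x (ordName P b) p) (hb : b < a) : fmem x (ordName P a) p := by
  rw [ordName, vonNeumann]
  exact fmem_check (A := fun b : {b : X // b < a} => vonNeumann b.1) (i := ⟨b, hb⟩) h

theorem exists_of_fmem_setName (h : fmem x (setName P A) p) (hq : q ≤ p) :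
    ∃ r ≤ q, ∃ b ∈ A, feq x (ordName P b) r := by
  obtain ⟨r, hr, i, h⟩ := exists_of_fmem_check h hq
  exact ⟨r, hr, i.1, i.2, h⟩

theorem fmem_setName (h : feq x (ordName P b) p) (hb : b ∈ A) : fmem x (setName P A) p :=
  fmem_check (A := fun a : A => vonNeumann a.1) (i := ⟨b, hb⟩) h

/-- Equality would make `b` a member of itself, hence equal to some `c < b`, and the induction
hypothesis at `b` excludes this. -/
theorem not_feq_ordName_of_lt (h : b < a) (p : P) : ¬ feq (ordName P b) (ordName P a) p := by
  induction a using WellFoundedLT.induction generalizing b p with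
  | ind a ih =>
    intro e
    obtain ⟨r, -, c, hc, e'⟩ := exists_of_fmem_ordName
      (fmem_congr_right (feq_symm e) (fmem_ordName (feq_refl (ordName P b) p) h)) le_rfl
    exact ih b h hc r (feq_symm e')

theorem eq_of_feq_ordName (h : feq (ordName P a) (ordName P b) p) : a = b := by
  rcases lt_trichotomy a b with hab | hab | hab
  · exact absurd h (not_feq_ordName_of_lt hab p)
  · exact hab
  · exact absurd (feq_symm h) (not_feq_ordName_of_lt hab p)

theorem lt_of_fmem_ordName (h : fmem (ordName P a) (ordName P b) p) : a < b := by
  obtain ⟨r, -, c, hc, e⟩ := exists_of_fmem_ordName h le_rfl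
  rwa [eq_of_feq_ordName e]

theorem fmem_relName {r : X → X → Prop}
    (h : feq x (opName (ordName P a) (ordName P b)) p) (hab : r a b) :
    fmem x (relName P r) p := by
  rw [relName, fmem]
  exact fun q hq => ⟨q, le_rfl, (⟨(a, b), hab⟩, q), le_rfl, feq_mono h hq⟩

theorem rel_of_fmem_relName {r : X → X → Prop}
    (h : fmem (opName (ordName P a) (ordName P b)) (relName P r) p) : r a b := by
  rw [relName, fmem] at h
  obtain ⟨s, _, ⟨⟨⟨c, d⟩, hcd⟩, _⟩, _, e⟩ := h p le_rfl
  rw [eq_of_feq_ordName (feq_left_of_opName_feq e), eq_of_feq_ordName (feq_right_of_opName_feq e)]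
  exact hcd

end
end

/-! ### Forced functions and the club of their closure points -/

section
variable {P : Type u} [Preorder P] {p q : P}

theorem fbex_intro {A y : PName P} {φ : PName P → Sentence P} (hy : fmem y A p)
    (h : ∀ q ≤ p, φ y q) : fbex A φ p :=
  fun q hq => ⟨q, le_rfl, y, fmem_mono hy hq, h q hq⟩

variable {X : Type u}

/-- `p` forces the relation `F` between ordinals to be a function with domain `D`. -/
structure IsForcedFunction (F : X → X → Sentence P) (D : Set X) (p : P) : Prop where
  mono : ∀ {i x q r}, r ≤ q → F i x q → F i x r
  functional : ∀ {i x y q}, q ≤ p → F i x q → F i y q → x = y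
  total : ∀ {i q}, i ∈ D → q ≤ p → ∃ r ≤ q, ∃ x, F i x r

theorem IsForcedFunction.of_le {F : X → X → Sentence P} {D E : Set X}
    (h : IsForcedFunction F D p) (hq : q ≤ p) (hE : E ⊆ D) : IsForcedFunction F E q :=
  ⟨h.mono, fun hr => h.functional (hr.trans hq), fun hi hr => h.total (hE hi) (hr.trans hq)⟩

variable [LinearOrder X]

/-- `b` is a strict upper bound of the values of `F` on the ordinals below `l`. -/
def IsForcedBound (F : X → X → Sentence P) (l b : X) : Sentence P :=
  fun q => ∀ i < l, ∀ x, ∀ s ≤ q, F i x s → x < b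

/-- `b` is the least strict upper bound of the values of `F` on the ordinals below `l`. -/
def IsForcedLeastBound (F : X → X → Sentence P) (l b : X) : Sentence P :=
  fun q => IsForcedBound F l b q ∧ ∀ c < b, ∀ s ≤ q, ¬ IsForcedBound F l c s

theorem IsForcedBound.mono {F : X → X → Sentence P} {l b : X} (h : IsForcedBound F l b p)
    (hq : q ≤ p) : IsForcedBound F l b q :=
  fun i hi x s hs => h i hi x s (hs.trans hq)

theorem IsForcedLeastBound.mono {F : X → X → Sentence P} {l b : X}
    (h : IsForcedLeastBound F l b p) (hq : q ≤ p) : IsForcedLeastBound F l b q :=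
  ⟨h.1.mono hq, fun c hc s hs => h.2 c hc s (hs.trans hq)⟩

theorem IsForcedLeastBound.unique {F : X → X → Sentence P} {l b c : X}
    (hb : IsForcedLeastBound F l b p) (hc : IsForcedLeastBound F l c p) : b = c := by
  rcases lt_trichotomy b c with h | h | h
  · exact absurd hb.1 (hc.2 b h p le_rfl)
  · exact h
  · exact absurd hc.1 (hb.2 c h p le_rfl)

/-- The iterates of `a` under the map sending `z` to the least strict upper bound of the values of
`F` on the ordinals below `next z`. -/
def boundIterate (F : X → X → Sentence P) (next : X → X) (a : X) : ℕ → X → Sentence P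
  | 0, y => fun _ => y = a
  | n + 1, y => fun q => ∃ z, boundIterate F next a n z q ∧ IsForcedLeastBound F (next z) y q

theorem boundIterate_mono {F : X → X → Sentence P} {next : X → X} {a : X} {n : ℕ} {y : X}
    (h : boundIterate F next a n y p) (hq : q ≤ p) : boundIterate F next a n y q := by
  induction n generalizing y with
  | zero => exact h
  | succ n ih =>
    obtain ⟨z, hz, hy⟩ := h
    exact ⟨z, ih hz, hy.mono hq⟩

theorem boundIterate_unique {F : X → X → Sentence P} {next : X → X} {a : X} {n : ℕ} {y z : X}
    (hy : boundIterate F next a n y p) (hz : boundIterate F next a n z p) : y = z := by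
  induction n generalizing y z with
  | zero => exact hy.trans hz.symm
  | succ n ih =>
    obtain ⟨y', hy', hy⟩ := hy
    obtain ⟨z', hz', hz⟩ := hz
    obtain rfl := ih hy' hz'
    exact hy.unique hz

variable [WellFoundedLT X]

/-- The value name `t i x` is left free: with `ordName P x` the graph is that of `F` itself, with a
pair name it maps `i` to the pair `(i, F i)`. -/
theorem exists_of_fmem_graph {l : X} {F : X → X → Sentence P} {t : X → X → PName P}
    (hF : IsForcedFunction F (Set.Iio l) p) {z : PName P}
    (h : fmem z (comprehension (fun i : Set.Iio l × X => opName (ordName P i.1.1) (t i.1 i.2))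
      (fun i => F i.1 i.2)) q) :
    ∃ r ≤ q, ∃ i < l, ∃ x, F i x r ∧ feq z (opName (ordName P i) (t i x)) r := by
  obtain ⟨r, hr, ⟨⟨i, hi⟩, x⟩, h, e⟩ :=
    exists_of_fmem_comprehension (fun _ _ _ h => by exact hF.mono h) h le_rfl
  exact ⟨r, hr, i, hi, x, h, e⟩

theorem fmem_graph {l : X} {F : X → X → Sentence P} {t : X → X → PName P} {i x : X}
    (hi : i < l) (h : F i x q) {z : PName P} (e : feq z (opName (ordName P i) (t i x)) q) :
    fmem z (comprehension (fun i : Set.Iio l × X => opName (ordName P i.1.1) (t i.1 i.2))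
      (fun i => F i.1 i.2)) q :=
  fmem_comprehension (e := fun i : Set.Iio l × X => opName (ordName P i.1.1) (t i.1 i.2))
    (i := (⟨i, hi⟩, x)) h e

theorem ffun_graph {l : X} {F : X → X → Sentence P} {t : X → X → PName P} {B : PName P}
    (hF : IsForcedFunction F (Set.Iio l) p) (ht : ∀ i < l, ∀ x, ∀ q ≤ p, F i x q → fmem (t i x) B q) :
    ffun (comprehension (fun i : Set.Iio l × X => opName (ordName P i.1.1) (t i.1 i.2))
      (fun i => F i.1 i.2)) (ordName P l) B p := by
  refine ⟨fun z q hq hz s hs => ?_, fun x q hq hx s hs => ?_⟩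
  · obtain ⟨r, hr, i, hi, x, h, e⟩ := exists_of_fmem_graph hF (fmem_mono hz hs)
    exact ⟨r, hr, ordName P i, fmem_ordName (feq_refl _ _) hi,
      fbex_intro (ht i hi x r (hr.trans (hs.trans hq)) h) fun q hq => feq_mono e hq⟩
  · obtain ⟨r, hr, i, hi, e⟩ := exists_of_fmem_ordName hx hs
    obtain ⟨r', hr', v, hv⟩ := hF.total hi (hr.trans (hs.trans hq))
    have hp : r' ≤ p := hr'.trans (hr.trans (hs.trans hq))
    refine ⟨r', hr'.trans hr, t i v, ht i hi v r' hp hv,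
      fmem_graph hi hv (opName_congr (feq_mono e hr') (feq_refl _ _)), fun y' q' hq' hy' => ?_⟩
    refine feq_of_dense fun s' hs' => ?_
    obtain ⟨r₂, hr₂, j, hj, w, hw, e₂⟩ := exists_of_fmem_graph hF (fmem_mono hy' hs')
    have hle : r₂ ≤ r' := hr₂.trans (hs'.trans hq')
    obtain rfl : i = j := eq_of_feq_ordName
      (feq_trans (feq_symm (feq_mono e (hle.trans hr'))) (feq_left_of_opName_feq e₂))
    obtain rfl : v = w := hF.functional (hle.trans hp) (hF.mono hle hv) hw
    exact ⟨r₂, hr₂, feq_right_of_opName_feq e₂⟩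

/-- The minimum is taken over the bounds forced by any extension of `p`, so no further extension can
lower it. -/
theorem exists_isForcedLeastBound {F : X → X → Sentence P} {l b : X}
    (h : IsForcedBound F l b p) : ∃ q ≤ p, ∃ c, IsForcedLeastBound F l c q := by
  obtain ⟨c, ⟨q, hq, hc⟩, hmin⟩ := WellFounded.has_min (wellFounded_lt (α := X))
    {c | ∃ q ≤ p, IsForcedBound F l c q} ⟨b, p, le_rfl, h⟩
  exact ⟨q, hq, c, hc, fun d hd s hs hds => hmin d ⟨s, hs.trans hq, hds⟩ hd⟩

theorem exists_isForcedBound_of_fregular {F : X → X → Sentence P} {l : X}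
    (hreg : fregular (setName P (Set.univ : Set X)) p) (hF : IsForcedFunction F (Set.Iio l) p) :
    ∃ q ≤ p, ∃ b, IsForcedBound F l b q := by
  have hfun := ffun_graph (B := setName P (Set.univ : Set X)) (t := fun _ x => ordName P x) hF
    fun i hi x q _ _ => fmem_setName (feq_refl _ _) (Set.mem_univ x)
  obtain ⟨r, hr, b, hb, h⟩ := hreg.2.2 (ordName P l) p le_rfl
    (fmem_setName (feq_refl _ _) (Set.mem_univ l)) _ p le_rfl hfun p le_rfl
  obtain ⟨r', hr', c, -, e⟩ := exists_of_fmem_setName hb le_rfl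
  refine ⟨r', hr'.trans hr, c, fun i hi x s hs hx => ?_⟩
  have := h (ordName P i) s (hs.trans hr') (fmem_ordName (feq_refl _ _) hi) (ordName P x) s le_rfl
    (fmem_graph (t := fun _ x => ordName P x) hi hx (feq_refl _ _))
  exact lt_of_fmem_ordName (fmem_congr_right (feq_mono e hs) this)

theorem exists_gt_of_fregular (hreg : fregular (setName P (Set.univ : Set X)) p) (a : X) :
    ∃ b, a < b := by
  obtain ⟨r, hr, y, hy, h⟩ := hreg.2.1 (ordName P a) p le_rfl
    (fmem_setName (feq_refl _ _) (Set.mem_univ a)) p le_rfl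
  obtain ⟨s, hs, b, -, e⟩ := exists_of_fmem_setName hy le_rfl
  exact ⟨b, lt_of_fmem_ordName (fmem_congr_right e (fmem_mono h hs))⟩

/-- The name of the set of all ordinals that are closed under `F`. -/
noncomputable def closurePoints (F : X → X → Sentence P) : PName P :=
  comprehension (ordName P) fun a => IsForcedBound F a a

theorem exists_of_fmem_closurePoints {F : X → X → Sentence P} {x : PName P}
    (h : fmem x (closurePoints F) p) :
    ∃ q ≤ p, ∃ a, IsForcedBound F a a q ∧ feq x (ordName P a) q :=
  exists_of_fmem_comprehension (fun _ _ _ hq h => IsForcedBound.mono h hq) h le_rfl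

theorem fregular_mono {k : PName P} (h : fregular k p) (hq : q ≤ p) : fregular k q :=
  ⟨fun r hr => h.1 r (hr.trans hq), fun x r hr => h.2.1 x r (hr.trans hq),
    fun x r hr => h.2.2 x r (hr.trans hq)⟩

theorem exists_boundIterate_succ {F : X → X → Sentence P} {next : X → X} {a z : X} {n : ℕ}
    (hreg : fregular (setName P (Set.univ : Set X)) p) (hF : IsForcedFunction F Set.univ p)
    (hz : boundIterate F next a n z p) :
    ∃ q ≤ p, ∃ y, IsForcedLeastBound F (next z) y q ∧ boundIterate F next a (n + 1) y q := by
  obtain ⟨q, hq, b, hb⟩ := exists_isForcedBound_of_fregular (l := next z) hreg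
    (hF.of_le le_rfl (Set.subset_univ _))
  obtain ⟨r, hr, c, hc⟩ := exists_isForcedLeastBound hb
  exact ⟨r, hr.trans hq, c, hc, z, boundIterate_mono hz (hr.trans hq), hc⟩

theorem exists_boundIterate {F : X → X → Sentence P} {next : X → X} {a : X}
    (hreg : fregular (setName P (Set.univ : Set X)) p) (hF : IsForcedFunction F Set.univ p)
    (n : ℕ) (hq : q ≤ p) : ∃ r ≤ q, ∃ y, boundIterate F next a n y r := by
  induction n with
  | zero => exact ⟨q, le_rfl, a, rfl⟩
  | succ n ih =>
    obtain ⟨r, hr, z, hz⟩ := ih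
    obtain ⟨s, hs, y, -, hy⟩ := exists_boundIterate_succ
      (fregular_mono hreg (hr.trans hq)) (hF.of_le (hr.trans hq) le_rfl) hz
    exact ⟨s, hs.trans hr, y, hy⟩

/-- In an ordinal of uncountable cofinality, closure points are unbounded. -/
theorem exists_isForcedBound_self {F : X → X → Sentence P} {e : ℕ → X} {w : X}
    (he : Function.Injective e) (hw : ∀ i < w, ∃ n, e n = i) (hew : ∀ n, e n < w)
    (hreg : fregular (setName P (Set.univ : Set X)) p) (hF : IsForcedFunction F Set.univ p)
    (a : X) : ∃ q ≤ p, ∃ b, a < b ∧ IsForcedBound F b b q := by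
  -- A bound for the indices below `next z` also covers the index `z`, as bounds only concern
  -- indices strictly below.
  choose next hnext using exists_gt_of_fregular hreg
  -- The sequence of iterates, indexed by the copy `w` of `ω` inside `X` so that regularity bounds
  -- it.
  let G : X → X → Sentence P := fun i y q => ∃ n, e n = i ∧ boundIterate F next a n y q
  have hG : IsForcedFunction G (Set.Iio w) p := by
    refine ⟨?_, ?_, ?_⟩
    · rintro i x q r hr ⟨n, hn, h⟩
      exact ⟨n, hn, boundIterate_mono h hr⟩
    · rintro i x y q - ⟨n, rfl, h⟩ ⟨m, hm, h'⟩
      obtain rfl := he hm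
      exact boundIterate_unique h h'
    · intro i q hi hq
      obtain ⟨n, hn⟩ := hw i hi
      obtain ⟨r, hr, y, hy⟩ := exists_boundIterate (next := next) (a := a) hreg hF n hq
      exact ⟨r, hr, y, n, hn, hy⟩
  obtain ⟨q₀, hq₀, b₀, hb₀⟩ := exists_isForcedBound_of_fregular hreg hG
  obtain ⟨q, hq, b, hb⟩ := exists_isForcedLeastBound hb₀
  have hqp : q ≤ p := hq.trans hq₀
  refine ⟨q, hqp, b, hb.1 (e 0) (hew 0) a q le_rfl ⟨0, rfl, rfl⟩, fun i hi x s hs hx => ?_⟩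
  -- As `b` is the least bound of the iterates, `i < b` is passed by some iterate `z`; the next
  -- iterate exceeds the value at `i` and is still below `b`.
  have hnot := hb.2 i hi s hs
  simp only [IsForcedBound, not_forall, not_lt] at hnot
  obtain ⟨_, -, z, s₁, hs₁, ⟨n, -, hz⟩, hiz⟩ := hnot
  obtain ⟨s₂, hs₂, y, hy, hy'⟩ := exists_boundIterate_succ
    (fregular_mono hreg (hs₁.trans (hs.trans hqp)))
    (hF.of_le (hs₁.trans (hs.trans hqp)) le_rfl) hz
  exact (hy.1 i (hiz.trans_lt (hnext z)) x s₂ le_rfl (hF.mono (hs₂.trans hs₁) hx)).trans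
    (hb.1 (e (n + 1)) (hew _) y s₂ (hs₂.trans (hs₁.trans hs)) ⟨n + 1, rfl, hy'⟩)

theorem fclub_closurePoints {F : X → X → Sentence P} {e : ℕ → X} {w : X}
    (he : Function.Injective e) (hw : ∀ i < w, ∃ n, e n = i) (hew : ∀ n, e n < w)
    (hreg : fregular (setName P (Set.univ : Set X)) p) (hF : IsForcedFunction F Set.univ p) :
    fclub (closurePoints F) (setName P (Set.univ : Set X)) p := by
  refine ⟨fun z q _ hz => fmem_of_dense fun s hs => ?_, fun x q hq hx s hs => ?_,
    fun d q hq hd q₁ hq₁ _ q₂ hq₂ hcof => fmem_of_dense fun s hs => ?_⟩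
  · obtain ⟨r, hr, a, -, e⟩ := exists_of_fmem_closurePoints (fmem_mono hz hs)
    exact ⟨r, hr, fmem_setName e (Set.mem_univ a)⟩
  · obtain ⟨r, hr, a, -, e'⟩ := exists_of_fmem_setName hx hs
    have hrp := hr.trans (hs.trans hq)
    obtain ⟨t, ht, b, hab, hb⟩ := exists_isForcedBound_self he hw hew (fregular_mono hreg hrp)
      (hF.of_le hrp le_rfl) a
    exact ⟨t, ht.trans hr, ordName P b, fmem_comprehension hb (feq_refl _ _),
      fmem_ordName (feq_mono e' ht) hab⟩
  · obtain ⟨r, hr, a, -, e'⟩ := exists_of_fmem_setName hd (hs.trans (hq₂.trans hq₁))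
    -- Closure: any `i < a` lies below a closure point `c < a`, and the value at `i` is below `c`.
    refine ⟨r, hr, fmem_comprehension (i := a) (fun i hi x t ht hx => ?_) e'⟩
    have hid : fmem (ordName P i) d t :=
      fmem_congr_right (feq_symm (feq_mono e' ht)) (fmem_ordName (feq_refl _ _) hi)
    obtain ⟨t₁, ht₁, y, hyd, hyC, hiy⟩ :=
      hcof (ordName P i) t (ht.trans (hr.trans hs)) hid t le_rfl
    obtain ⟨t₂, ht₂, c, hc, ec⟩ := exists_of_fmem_closurePoints hyC
    have hic : i < c := lt_of_fmem_ordName (fmem_congr_right ec (fmem_mono hiy ht₂))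
    have hca : c < a := lt_of_fmem_ordName (fmem_congr_left ec
      (fmem_congr_right (feq_mono e' (ht₂.trans (ht₁.trans ht))) (fmem_mono hyd ht₂)))
    exact (hc i hic x t₂ le_rfl (hF.mono (ht₂.trans ht₁) hx)).trans hca

end

/-! ### Increasing enumerations of branches -/

section
variable {P : Type u} [Preorder P] {p q : P}
variable {X : Type u} [LinearOrder X]

/-- `p` forces `F` to enumerate increasingly an initial segment of a branch of the tree `R`. -/
structure IsForcedEnumeration (R : X → X → Prop) (F : X → X → Sentence P) (p : P) : Prop
    extends IsForcedFunction F Set.univ p where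
  rel : ∀ {i j x y q}, q ≤ p → F i x q → F j y q → i < j → R x y
  downward : ∀ {i x y q}, q ≤ p → F i x q → R y x → ∃ r ≤ q, ∃ j, F j y r

namespace IsForcedEnumeration

variable {R : X → X → Prop} {F : X → X → Sentence P}

theorem exists_index_lt (hR : ∀ x y, R x y → x < y) (h : IsForcedEnumeration R F p) {i x y : X}
    (hq : q ≤ p) (hx : F i x q) (hyx : R y x) : ∃ r ≤ q, ∃ j < i, F j y r := by
  obtain ⟨r, hr, j, hj⟩ := h.downward hq hx hyx
  refine ⟨r, hr, j, ?_, hj⟩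
  have hx' := h.mono hr hx
  rcases lt_trichotomy j i with hji | rfl | hij
  · exact hji
  · exact absurd (hR _ _ hyx) (h.functional (hr.trans hq) hj hx' ▸ lt_irrefl _)
  · exact absurd (hR _ _ hyx) (hR _ _ (h.rel (hr.trans hq) hx' hj hij)).asymm

theorem exists_value_rel (h : IsForcedEnumeration R F p) {i j x : X}
    (hq : q ≤ p) (hx : F i x q) (hji : j < i) : ∃ r ≤ q, ∃ y, F j y r ∧ R y x := by
  obtain ⟨r, hr, y, hy⟩ := h.total (Set.mem_univ j) hq
  exact ⟨r, hr, y, hy, h.rel (hr.trans hq) hy (h.mono hr hx) hji⟩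

variable [WellFoundedLT X]

/-- The conditions `q` and `s` may be incompatible. The index of `x` is the order type of its
predecessors, which does not depend on the generic. If the indices differed, the predecessor of `x`
sitting at the smaller one would have a still smaller index under the other condition. -/
theorem index_unique (hR : ∀ x y, R x y → x < y) (h : IsForcedEnumeration R F p) {i j x : X}
    {s : P} (hq : q ≤ p) (hi : F i x q) (hs : s ≤ p) (hj : F j x s) : i = j := by
  induction i using WellFoundedLT.induction generalizing j x q s with
  | ind i ih =>
    rcases lt_trichotomy i j with hij | hij | hji
    · obtain ⟨s', hs', y, hy, hyx⟩ := h.exists_value_rel hs hj hij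
      obtain ⟨q', hq', k, hk, hky⟩ := h.exists_index_lt hR hq hi hyx
      exact absurd (ih k hk (hq'.trans hq) hky (hs'.trans hs) hy) hk.ne
    · exact hij
    · obtain ⟨q', hq', y, hy, hyx⟩ := h.exists_value_rel hq hi hji
      obtain ⟨s', hs', k, hk, hky⟩ := h.exists_index_lt hR hs hj hyx
      exact absurd (ih j hji (hq'.trans hq) hy (hs'.trans hs) hky) hk.ne'

/-- Strictly increasing maps of ordinals lie above the identity: if `x < i`, the value at index `x`
would be smaller than `x`. -/
theorem index_le (hR : ∀ x y, R x y → x < y) (h : IsForcedEnumeration R F p) {i x : X}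
    (hq : q ≤ p) (hi : F i x q) : i ≤ x := by
  induction i using WellFoundedLT.induction generalizing x q with
  | ind i ih =>
    by_contra! hlt
    obtain ⟨r, hr, y, hy, hyx⟩ := h.exists_value_rel hq hi hlt
    exact (ih x hlt (hr.trans hq) hy).not_gt (hR _ _ hyx)

/-- The isomorphism is built in the ground model: each predecessor gets an index forced by some
condition of its own, and `index_unique` makes these choices cohere. -/
theorem hasLength_predecessors (hR : ∀ x y, R x y → x < y) (htree : IsTreeOrder R)
    (h : IsForcedEnumeration R F p) {a v : X} (hv : F a v p) :
    HasLength (Y := Set.Iio a) R {y | R y v} := by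
  have hidx : ∀ y : {y | R y v}, ∃ j : Set.Iio a, ∃ q ≤ p, F j y q := by
    rintro ⟨y, hy⟩
    obtain ⟨r, hr, j, hj, hjy⟩ := h.exists_index_lt hR le_rfl hv hy
    exact ⟨⟨j, hj⟩, r, hr, hjy⟩
  choose idx hidx using hidx
  have hmono : ∀ y z : {y | R y v}, R y z → idx y < idx z := by
    intro y z hyz
    obtain ⟨q, hq, hz⟩ := hidx z
    obtain ⟨s, hs, hy⟩ := hidx y
    obtain ⟨r, hr, k, hk, hky⟩ := h.exists_index_lt hR hq hz hyz
    have := h.index_unique hR (hr.trans hq) hky hs hy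
    exact Subtype.coe_lt_coe.1 (this ▸ hk)
  have htri : ∀ y z : {y | R y v}, R y z ∨ y = z ∨ R z y := by
    intro y z
    have := htree.wellOrdered v
    exact trichotomous_of (fun y z : {y // R y v} => R y.1 z.1) y z
  have hiff : ∀ y z : {y | R y v}, idx y < idx z ↔ R y z := by
    refine fun y z => ⟨fun hlt => ?_, hmono y z⟩
    rcases htri y z with hyz | rfl | hzy
    · exact hyz
    · exact absurd hlt (lt_irrefl _)
    · exact absurd hlt (hmono z y hzy).asymm
  refine ⟨⟨Equiv.ofBijective idx ⟨fun y z hyz => ?_, fun j => ?_⟩, fun {y z} => hiff y z⟩⟩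
  · rcases htri y z with h' | h' | h'
    · exact absurd hyz (hmono _ _ h').ne
    · exact h'
    · exact absurd hyz (hmono _ _ h').ne'
  · obtain ⟨r, hr, y, hy, hyv⟩ := h.exists_value_rel le_rfl hv j.2
    obtain ⟨s, hs, hs'⟩ := hidx ⟨y, hyv⟩
    exact ⟨⟨y, hyv⟩, Subtype.ext (h.index_unique hR hs hs' hr hy)⟩

theorem isBranchIn_predecessors (hR : ∀ x y, R x y → x < y) (htree : IsTreeOrder R)
    (h : IsForcedEnumeration R F p) {a v : X} (hv : F a v p) (ha : IsForcedBound F a a p) :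
    IsBranchIn R (Set.Iio a) {y | R y v} := by
  refine ⟨fun y hy => ?_, fun x hx y hy => ?_, fun x hx hcomp => ?_⟩
  · obtain ⟨r, hr, j, hj, hjy⟩ := h.exists_index_lt hR le_rfl hv hy
    exact ha j hj y r hr hjy
  · have := htree.wellOrdered v
    rcases trichotomous_of (fun y z : {y // R y v} => R y.1 z.1) ⟨x, hx⟩ ⟨y, hy⟩ with h | h | h
    · exact Or.inr (Or.inl h)
    · exact Or.inl (congrArg Subtype.val h)
    · exact Or.inr (Or.inr h)
  -- Maximality: compare `x` with the value `y` at index `x`. Since `x ≤ y`, the node `y` cannot be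
  -- a tree predecessor of `x`.
  · obtain ⟨r, hr, y, hy, hyv⟩ := h.exists_value_rel le_rfl hv hx
    rcases hcomp y hyv with rfl | hxy | hyx
    · exact hyv
    · exact htree.trans _ _ _ hxy hyv
    · exact absurd (hR _ _ hyx) (h.index_le hR hr hy).not_gt

end IsForcedEnumeration

variable [WellFoundedLT X]

/-- The relation between ordinals given by a name `f` of a set of ordered pairs. -/
noncomputable def nameRel (f : PName P) (i x : X) : Sentence P :=
  opName (ordName P i) (ordName P x) ∈ᶠ f

theorem comparable_of_fcomparable {R : X → X → Prop} {a b : X} {z : PName P}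
    (e : feq z (ordName P b) p) (h : fcomparable (relName P R) (ordName P a) z p) :
    a = b ∨ R a b ∨ R b a := by
  obtain ⟨q, hq, h | h⟩ := h p le_rfl
  · exact Or.inl (eq_of_feq_ordName (feq_trans h (feq_mono e hq)))
  obtain ⟨r, hr, h | h⟩ := h q le_rfl
  · exact Or.inr (Or.inl (rel_of_fmem_relName
      (fmem_congr_left (opName_congr (feq_refl _ _) (feq_mono e (hr.trans hq))) h)))
  · exact Or.inr (Or.inr (rel_of_fmem_relName
      (fmem_congr_left (opName_congr (feq_mono e (hr.trans hq)) (feq_refl _ _)) h)))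

theorem fcomparable_of_comparable {R : X → X → Prop} {a b : X} {z : PName P}
    (e : feq z (ordName P b) p) (h : a = b ∨ R a b ∨ R b a) :
    fcomparable (relName P R) (ordName P a) z p := by
  intro q hq
  refine ⟨q, le_rfl, ?_⟩
  rcases h with rfl | h
  · exact Or.inl (feq_mono (feq_symm e) hq)
  refine Or.inr fun r hr => ⟨r, le_rfl, ?_⟩
  have e' := feq_mono e (hr.trans hq)
  exact h.imp (fmem_relName (opName_congr (feq_refl _ _) e'))
    (fmem_relName (opName_congr e' (feq_refl _ _)))

theorem isForcedEnumeration_nameRel {R : X → X → Prop} (htree : IsTreeOrder R) {B f : PName P}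
    (hbranch : fbranch B (setName P (Set.univ : Set X)) (relName P R) p)
    (hf : fiso f (setName P (Set.univ : Set X)) B (relName P R) p) :
    IsForcedEnumeration R (nameRel (X := X) f) p := by
  obtain ⟨hsub, hchain, hmax⟩ := hbranch
  obtain ⟨⟨⟨hpairs, hfun⟩, hsurj⟩, horder⟩ := hf
  have huniv : ∀ (i : X) (q : P), fmem (ordName P i) (setName P (Set.univ : Set X)) q :=
    fun i q => fmem_setName (feq_refl _ _) (Set.mem_univ i)
  have hB : ∀ {i x : X} {q : P}, q ≤ p → nameRel f i x q → fmem (ordName P x) B q := by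
    intro i x q hq h
    refine fmem_of_dense fun s hs => ?_
    obtain ⟨r, hr, x', -, h'⟩ := hpairs _ q hq h s hs
    obtain ⟨r', hr', y', hy', e⟩ := h' r le_rfl
    exact ⟨r', hr'.trans hr, fmem_congr_left (feq_symm (feq_right_of_opName_feq e)) hy'⟩
  refine ⟨⟨fun hr h => fmem_mono h hr, fun {i x y q} hq hx hy => ?_, fun {i q} _ hq => ?_⟩,
    fun {i j x y q} hq hx hy hij => ?_, fun {i x y q} hq hx hyx => ?_⟩
  · obtain ⟨r, hr, z, -, -, hz⟩ := hfun (ordName P i) q hq (huniv i q) q le_rfl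
    exact eq_of_feq_ordName (feq_trans (hz _ r le_rfl (fmem_mono hx hr))
      (feq_symm (hz _ r le_rfl (fmem_mono hy hr))))
  · obtain ⟨r, hr, y, hyB, hy, -⟩ := hfun (ordName P i) q hq (huniv i q) q le_rfl
    obtain ⟨s, hs, x, -, e⟩ :=
      exists_of_fmem_setName (hsub y r (hr.trans hq) hyB) le_rfl
    exact ⟨s, hs.trans hr, x, fmem_congr_left (opName_congr (feq_refl _ _) e) (fmem_mono hy hs)⟩
  · exact rel_of_fmem_relName ((horder (ordName P i) q hq (huniv i q) (ordName P j) q le_rfl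
      (huniv j q) (ordName P x) (ordName P y) q le_rfl hx q le_rfl hy).2.1 q le_rfl
      (fmem_ordName (feq_refl _ _) hij))
  -- A predecessor of a branch element is comparable with the whole branch, so maximality puts it in
  -- the branch.
  · have hyB : fmem (ordName P y) B q := by
      refine hmax (ordName P y) q hq (huniv y q) q le_rfl fun z s hs hz t ht => ?_
      obtain ⟨t', ht', c, -, e⟩ := exists_of_fmem_setName (hsub z s (hs.trans hq) hz) ht
      have hxz := comparable_of_fcomparable e fun t₁ ht₁ =>
        hchain _ q hq (hB hq hx) z s hs hz t₁ (ht₁.trans (ht'.trans ht))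
      suffices hyc : y = c ∨ R y c ∨ R c y by
        obtain ⟨t₂, ht₂, h⟩ := fcomparable_of_comparable e hyc t' le_rfl
        exact ⟨t₂, ht₂.trans ht', h⟩
      rcases hxz with rfl | hxz | hzx
      · exact Or.inr (Or.inl hyx)
      · exact Or.inr (Or.inl (htree.trans _ _ _ hyx hxz))
      · have := htree.wellOrdered x
        rcases trichotomous_of (fun y z : {y // R y x} => R y.1 z.1) ⟨y, hyx⟩ ⟨c, hzx⟩
          with h | h | h
        · exact Or.inr (Or.inl h)
        · exact Or.inl (congrArg Subtype.val h)
        · exact Or.inr (Or.inr h)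
    obtain ⟨r, hr, x', hx', h⟩ := hsurj _ q hq hyB q le_rfl
    obtain ⟨s, hs, j, -, e⟩ := exists_of_fmem_setName hx' le_rfl
    exact ⟨s, hs.trans hr, j, fmem_congr_left (opName_congr e (feq_refl _ _)) (fmem_mono h hs)⟩

end

/-! ### Preservation of regularity without new small sets -/

section
variable {P : Type u} [Preorder P] {p q : P}
variable {X : Type u} [LinearOrder X] [WellFoundedLT X]

theorem exists_of_fmem_of_ffun {l z f : PName P} {a : X} (e : feq l (ordName P a) p)
    (hf : ffun f l (setName P (Set.univ : Set X)) p) (hq : q ≤ p) (hz : fmem z f q) :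
    ∃ r ≤ q, ∃ i < a, ∃ x : X, feq z (opName (ordName P i) (ordName P x)) r := by
  obtain ⟨r₁, hr₁, x, hx, h⟩ := hf.1 z q hq hz q le_rfl
  obtain ⟨r₂, hr₂, y, hy, ez⟩ := h r₁ le_rfl
  obtain ⟨r₃, hr₃, i, hi, ex⟩ := exists_of_fmem_ordName
    (fmem_congr_right (feq_mono e (hr₁.trans hq)) hx) hr₂
  obtain ⟨r₄, hr₄, v, -, ey⟩ := exists_of_fmem_setName hy hr₃
  exact ⟨r₄, hr₄.trans (hr₃.trans (hr₂.trans hr₁)), i, hi, v,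
    feq_trans (feq_mono ez (hr₄.trans hr₃)) (opName_congr (feq_mono ex hr₄) ey)⟩

theorem isForcedFunction_nameRel {l f : PName P} {a : X} (e : feq l (ordName P a) p)
    (hf : ffun f l (setName P (Set.univ : Set X)) p) :
    IsForcedFunction (nameRel (X := X) f) (Set.Iio a) p := by
  refine ⟨fun hr h => fmem_mono h hr, fun {i x y q} hq hx hy => ?_, fun {i q} hi hq => ?_⟩
  -- Functionality is required at every index `i`; that `i` lies in the domain is recovered from the
  -- pair being in `f`.
  · obtain ⟨r₁, hr₁, j, hj, v, e'⟩ := exists_of_fmem_of_ffun e hf hq hx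
    have hi : fmem (ordName P i) l r₁ := fmem_congr_right
      (feq_symm (feq_mono e (hr₁.trans hq))) (fmem_ordName (feq_left_of_opName_feq e') hj)
    obtain ⟨r, hr, z, -, -, hz⟩ := hf.2 (ordName P i) r₁ (hr₁.trans hq) hi r₁ le_rfl
    exact eq_of_feq_ordName (feq_trans (hz _ r le_rfl (fmem_mono hx (hr.trans hr₁)))
      (feq_symm (hz _ r le_rfl (fmem_mono hy (hr.trans hr₁)))))
  · have hi : fmem (ordName P i) l q := fmem_congr_right
      (feq_symm (feq_mono e hq)) (fmem_ordName (feq_refl _ _) hi)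
    obtain ⟨r, hr, y, hyK, hy, -⟩ := hf.2 (ordName P i) q hq hi q le_rfl
    obtain ⟨s, hs, x, -, e⟩ := exists_of_fmem_setName hyK le_rfl
    exact ⟨s, hs.trans hr, x, fmem_congr_left (opName_congr (feq_refl _ _) e) (fmem_mono hy hs)⟩

/-- A function is the image of its domain. -/
theorem fcardLT_of_ffun {l f : PName P} {a : X} (e : feq l (ordName P a) p)
    (hf : ffun f l (setName P (Set.univ : Set X)) p) :
    fcardLT f (setName P (Set.univ : Set X)) p := by
  have hF := isForcedFunction_nameRel e hf
  -- The surjection from `a` onto `f` sends `i` to the pair `(i, f i)`.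
  let t : X → X → PName P := fun i x => opName (ordName P i) (ordName P x)
  refine fbex_intro (y := ordName P a) (fmem_setName (feq_refl _ _) (Set.mem_univ a))
    fun q hq s hs => ⟨s, le_rfl, _, ffun_graph (t := t)
      (hF.of_le (hs.trans hq) le_rfl) fun i hi x r hr h => h, fun z r hr hz r₁ hr₁ => ?_⟩
  obtain ⟨r₂, hr₂, i, hi, x, ez⟩ := exists_of_fmem_of_ffun e hf
    (hr₁.trans (hr.trans (hs.trans hq))) (fmem_mono hz hr₁)
  refine ⟨r₂, hr₂, ordName P i, fmem_ordName (feq_refl _ _) hi, fmem_graph hi ?_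
    (opName_congr (feq_refl _ _) ez)⟩
  exact fmem_congr_left ez (fmem_mono hz (hr₂.trans hr₁))

/-- Whether a pair of ordinals belongs to a ground model set does not depend on the condition. -/
theorem nameRel_of_feq_check {f : PName P} {Y : PSet.{u}} (hY : feq f (check P Y) p) {i x : X}
    (hq : q ≤ p) (h : nameRel f i x q) : nameRel f i x p := by
  obtain ⟨ι, Y⟩ := Y
  obtain ⟨r, hr, j, e⟩ := exists_of_fmem_check (fmem_congr_right (feq_mono hY hq) h) le_rfl
  refine fmem_congr_right (feq_symm hY) (fmem_check (i := j) ?_)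
  rw [ordName, ordName, ← check_groundOp] at e ⊢
  exact feq_check_of_feq_check e p

/-- If no new sequences are added, a regular ordinal remains regular. -/
theorem fregular_of_fground [Nonempty X] [NoMaxOrder X]
    (hreg : ∀ (l : X) (g : Set.Iio l → X), ∃ b, ∀ i, g i < b)
    (hP : ∀ (x : PName P) (p : P), ((fball x fun z => fground z) ∧ᶠ
      fcardLT x (setName P (Set.univ : Set X)) →ᶠ fground x) p) (p : P) :
    fregular (setName P (Set.univ : Set X)) p := by
  have huniv : ∀ (i : X) (q : P), fmem (ordName P i) (setName P (Set.univ : Set X)) q :=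
    fun i q => fmem_setName (feq_refl _ _) (Set.mem_univ i)
  refine ⟨fun q hq => ⟨q, le_rfl, ordName P (Classical.arbitrary X), huniv _ q⟩,
    fun x q hq hx s hs => ?_, fun l q hq hl f q₁ hq₁ hf s hs => ?_⟩
  · obtain ⟨r, hr, a, -, e⟩ := exists_of_fmem_setName hx hs
    obtain ⟨b, hb⟩ := exists_gt a
    exact ⟨r, hr, ordName P b, huniv b r, fmem_ordName e hb⟩
  · obtain ⟨r, hr, a, -, e⟩ := exists_of_fmem_setName hl (hs.trans hq₁)
    have hf' : ffun f l (setName P (Set.univ : Set X)) r :=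
      ⟨fun z t ht => hf.1 z t (ht.trans (hr.trans hs)),
        fun z t ht => hf.2 z t (ht.trans (hr.trans hs))⟩
    have hF := isForcedFunction_nameRel e hf'
    have hground : fball f (fun z => fground z) r := by
      intro z t ht hz t₁ ht₁
      obtain ⟨t₂, ht₂, i, -, x, ez⟩ := exists_of_fmem_of_ffun e hf' (ht₁.trans ht)
        (fmem_mono hz ht₁)
      refine ⟨t₂, ht₂, groundOp (vonNeumann i) (vonNeumann x), ?_⟩
      simpa only [check_groundOp, ordName] using ez
    obtain ⟨r', hr', Y, hY⟩ := hP f r r le_rfl ⟨hground, fcardLT_of_ffun e hf'⟩ r le_rfl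
    -- Since `r'` identifies `f` with a ground model set, it decides all values at once. They give a
    -- ground model function `g`, bounded by regularity there.
    have hval : ∀ i : Set.Iio a, ∃ x, nameRel f i.1 x r' := by
      intro i
      obtain ⟨t, ht, x, hx⟩ := hF.total i.2 hr'
      exact ⟨x, nameRel_of_feq_check hY ht hx⟩
    choose g hg using hval
    obtain ⟨b, hb⟩ := hreg a g
    refine ⟨r', hr'.trans hr, ordName P b, huniv b r', fun x t ht _ y t₁ ht₁ hxy =>
      fmem_of_dense fun t₂ ht₂ => ?_⟩
    have hle : t₂ ≤ r' := ht₂.trans (ht₁.trans ht)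
    obtain ⟨t₃, ht₃, i, hi, v, e'⟩ := exists_of_fmem_of_ffun e hf' (hle.trans hr')
      (fmem_mono hxy ht₂)
    have hv : nameRel f i v r' := nameRel_of_feq_check hY (ht₃.trans hle)
      (fmem_congr_left e' (fmem_mono hxy (ht₃.trans ht₂)))
    obtain rfl : v = g ⟨i, hi⟩ := hF.functional hr' hv (hg ⟨i, hi⟩)
    exact ⟨t₃, ht₃, fmem_ordName (feq_right_of_opName_feq e') (hb ⟨i, hi⟩)⟩

end

/-! ### The cardinal `κ` and the two claims -/

section
variable {κ : Cardinal.{u}}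

/-- An unbounded range would be cofinal, hence of size at least `κ`, while `l` has fewer than `κ`
predecessors. -/
theorem exists_forall_lt_of_isRegular (hκ : κ.IsRegular) (l : κ.ord.ToType)
    (g : Set.Iio l → κ.ord.ToType) : ∃ b, ∀ i, g i < b := by
  by_contra! h
  have hcof : IsCofinal (Set.range g) := fun b => by
    obtain ⟨i, hi⟩ := h b
    exact ⟨g i, ⟨i, rfl⟩, hi⟩
  have hle : κ ≤ #(Set.range g) :=
    hκ.le_cof_ord.trans ((Ordinal.cof_toType _).symm.le.trans (Order.cof_le hcof))
  have hlt := Cardinal.mk_Iio_lt l (by simp)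
  rw [Cardinal.mk_toType, Cardinal.card_ord] at hlt
  exact (hle.trans Cardinal.mk_range_le).not_gt hlt

/-- Here uncountability enters: `w` is the ordinal `ω` inside `κ` and `e` lists its elements. -/
theorem exists_omega_embedding (hunc : ℵ₀ < κ) :
    ∃ (e : ℕ → κ.ord.ToType) (w : κ.ord.ToType), Function.Injective e ∧
      (∀ i < w, ∃ n, e n = i) ∧ ∀ n, e n < w := by
  have hω : Ordinal.omega0 < κ.ord := by rwa [← Cardinal.ord_aleph0, Cardinal.ord_lt_ord]
  have hsurj : ∀ o < κ.ord, ∃ a : κ.ord.ToType, Ordinal.typein (α := κ.ord.ToType) (· < ·) a = o := fun o ho =>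
    Ordinal.typein_surj (α := κ.ord.ToType) (· < ·) (by rwa [Ordinal.type_toType])
  choose e he using fun n : ℕ => hsurj n ((Ordinal.natCast_lt_omega0 n).trans hω)
  obtain ⟨w, hw⟩ := hsurj _ hω
  refine ⟨e, w, fun n m h => ?_, fun i hi => ?_, fun n => ?_⟩
  · exact_mod_cast (he n).symm.trans ((congrArg _ h).trans (he m))
  · rw [← Ordinal.typein_lt_typein (α := κ.ord.ToType) (· < ·), hw, Ordinal.lt_omega0] at hi
    obtain ⟨n, hn⟩ := hi
    exact ⟨n, Ordinal.typein_injective (α := κ.ord.ToType) (· < ·) ((he n).trans hn.symm)⟩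
  · rw [← Ordinal.typein_lt_typein (α := κ.ord.ToType) (· < ·), he, hw]
    exact Ordinal.natCast_lt_omega0 n

theorem exists_fclub_fdisjoint_noBranchSet (hunc : ℵ₀ < κ)
    {R : κ.ord.ToType → κ.ord.ToType → Prop} (hR : IsRepresentation κ R)
    {P : Type u} [Preorder P] {p : P} (hbranch : fhasBranch P κ R p)
    (hreg : fregular (cardName P κ) p) :
    fex (fun C => fclub C (cardName P κ) ∧ᶠ fdisjoint C (setName P (noBranchSet κ R))) p := by
  obtain ⟨e, w, he, hw, hew⟩ := exists_omega_embedding hunc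
  intro q hq
  obtain ⟨r, hr, B, hB, hex⟩ := hbranch q hq
  obtain ⟨s, hs, f, hf⟩ := hex r le_rfl
  have hB' : fbranch B (cardName P κ) (relName P R) s :=
    ⟨fun x t ht => hB.1 x t (ht.trans hs), fun x t ht => hB.2.1 x t (ht.trans hs),
      fun x t ht => hB.2.2 x t (ht.trans hs)⟩
  have hF := isForcedEnumeration_nameRel hR.isTree hB' hf
  refine ⟨s, hs.trans hr, closurePoints (nameRel (X := κ.ord.ToType) f),
    fclub_closurePoints he hw hew (fregular_mono hreg (hs.trans (hr.trans hq)))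
      hF.toIsForcedFunction, fun t ht hmeet => ?_⟩
  obtain ⟨t₁, ht₁, x, hxC, hxS⟩ := hmeet t le_rfl
  obtain ⟨t₂, ht₂, a, ha, ea⟩ := exists_of_fmem_closurePoints hxC
  obtain ⟨t₃, ht₃, b, hb, eb⟩ := exists_of_fmem_setName hxS ht₂
  obtain rfl : a = b := eq_of_feq_ordName (feq_trans (feq_symm (feq_mono ea ht₃)) eb)
  have ht₃s : t₃ ≤ s := ht₃.trans (ht₂.trans (ht₁.trans ht))
  -- Now `a` is both a closure point and in `S`. Once its value `v` is decided, the predecessors of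
  -- `v` are a ground model branch of length `a`.
  obtain ⟨t₄, ht₄, v, hv⟩ := hF.total (Set.mem_univ a) ht₃s
  have hF' : IsForcedEnumeration R (nameRel (X := κ.ord.ToType) f) t₄ :=
    ⟨hF.toIsForcedFunction.of_le (ht₄.trans ht₃s) le_rfl,
      fun h => hF.rel (h.trans (ht₄.trans ht₃s)), fun h => hF.downward (h.trans (ht₄.trans ht₃s))⟩
  exact hb ⟨_, hF'.isBranchIn_predecessors hR.lt_of_rel hR.isTree hv (ha.mono (ht₄.trans ht₃)),
    hF'.hasLength_predecessors hR.lt_of_rel hR.isTree hv⟩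

theorem not_weaklySemiProper (hκ : κ.IsRegular) (hunc : ℵ₀ < κ)
    {R : κ.ord.ToType → κ.ord.ToType → Prop} (hR : IsRepresentation κ R)
    (hS : IsStationary (noBranchSet κ R)) : ¬ WeaklySemiProper κ R := by
  rintro ⟨P, _, ⟨p⟩, hbranch, hstat, hsmall⟩
  have : Nonempty κ.ord.ToType := hS.nonempty.to_type
  have : NoMaxOrder κ.ord.ToType := Cardinal.noMaxOrder hκ.aleph0_le
  have hreg : fregular (cardName P κ) p :=
    fregular_of_fground (exists_forall_lt_of_isRegular hκ) hsmall p
  obtain ⟨q, hq, C, hC, hdisj⟩ :=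
    exists_fclub_fdisjoint_noBranchSet hunc hR (hbranch p) hreg p le_rfl
  exact hdisj q le_rfl (hstat _ hS q C q le_rfl hC)

end
end Forcing

theorem lemma1 (κ : Cardinal.{u}) (hκ : κ.IsRegular) (hunc : ℵ₀ < κ)
    (r : κ.ord.ToType → κ.ord.ToType → Prop)
    (hrep : IsRepresentation κ r) (htree : IsCardTree (Order.succ κ) κ r) :
    (IsStationary (noBranchSet κ r) → ¬ Forcing.WeaklySemiProper κ r) ∧
    (∀ (P : Type u) [Preorder P] (p : P),
      Forcing.fhasBranch P κ r p →
      Forcing.fregular (Forcing.cardName P κ) p →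
      Forcing.fex (fun C : Forcing.PName P =>
        Forcing.fand (Forcing.fclub C (Forcing.cardName P κ))
          (Forcing.fdisjoint C (Forcing.setName P (noBranchSet κ r)))) p) :=
  ⟨Forcing.not_weaklySemiProper hκ hunc hrep, fun _ _ _ =>
    Forcing.exists_fclub_fdisjoint_noBranchSet hunc hrep⟩
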